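/- A \emph{simple polygon with $n$ vertices} ($n\ge 3$) is given by $n$ distinct points of the Euclidean plane in a cyclic order such that, when consecutive points are joined by closed segments, consecutive edges meet only in their common vertex and non-consecutive edges are disjoint. Straight angles at vertices are allowed, i.e. a vertex may lie on the segment between its two neighbours. The \emph{closed region enclosed by} such a polygon is its boundary curve together with its interior (the bounded part of the complement of the curve). \textbf{Theorem.} Let $L_1,\dots,L_l\ge 3$ be integers such that $L_j\ge 4$ for at least one $j$, and let $P$ be any set of exactly $\sum_{i=1}^l L_i$ points in the plane. Then the following are equivalent. (a) $P$ can be partitioned into sets $S_1,\dots,S_l$ with $|S_i|=L_i$ such that each $S_i$ is the vertex set of a simple polygon $C_i$ with $L_i$ vertices, and the closed regions enclosed by $C_1,\dots,C_l$ are pairwise disjoint. (b) Every collinear subset of $P$ has at most $\sum_{i=1}^l L_i-l$ points, i.e. no line contains more than $\sum_{i=1}^l L_i-l$ points of $P$. -/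

import Mathlib

namespace PolygonPartition

/-- The Euclidean plane. -/
abbrev Plane : Type := EuclideanSpace ℝ (Fin 2)

/-- A polygon in the plane, with cyclically ordered vertices `C 0, …, C (n - 1)`, is simple if it
has at least three vertices, its vertices are distinct, two consecutive edges meet only in their
common vertex, and two non-consecutive edges are disjoint. Straight angles are allowed: a vertex
may lie on the segment between its two neighbours. -/
structure IsSimple {n : ℕ} (C : Polygon Plane n) : Prop where
  three_le : 3 ≤ n
  injective : Function.Injective C.vertices
  consecutive : ∀ i : Fin n,
    C.edgeSet ℝ i ∩ C.edgeSet ℝ (finRotate n i) = {C (finRotate n i)}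
  nonconsecutive : ∀ i j : Fin n, i ≠ j → j ≠ finRotate n i → i ≠ finRotate n j →
    Disjoint (C.edgeSet ℝ i) (C.edgeSet ℝ j)

/-- The closed region enclosed by a polygon: its boundary curve together with every point whose
connected component in the complement of the boundary curve is bounded. -/
def closedRegion {n : ℕ} (C : Polygon Plane n) : Set Plane :=
  C.boundary ℝ ∪
    {x | x ∉ C.boundary ℝ ∧
      Bornology.IsBounded (connectedComponentIn (C.boundary ℝ)ᶜ x)}

/-- The polygons `C i`, with `L i` vertices each, form a disjoint cycle partition of the point
set `P`: each of them is simple, the closed regions that they enclose are pairwise disjoint, and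
the points of `P` are exactly the vertices of the polygons. (Every point of `P` is a vertex of
exactly one polygon, as the regions are disjoint.) -/
structure IsDisjointCyclePartition {l : ℕ} (L : Fin l → ℕ) (P : Finset Plane)
    (C : (i : Fin l) → Polygon Plane (L i)) : Prop where
  simple : ∀ i, IsSimple (C i)
  disjoint : ∀ i j, i ≠ j → Disjoint (closedRegion (C i)) (closedRegion (C j))
  vertices : (⋃ i, Set.range (C i).vertices) = (P : Set Plane)

end PolygonPartition

/-! Necessity: the vertices of a simple polygon are not collinear (`IsSimple.not_collinear`), so
each of the `l` polygons has a vertex off any given line, and these vertices are distinct because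
the regions are disjoint.

Sufficiency is proved by induction on the number `l` of polygons
(`hasPartition_of_collinear_card_le`), in two cases. If some line carries at least `2 * l` points,
hypothesis (b) leaves at least `l` points off it, so every polygon can be allotted at least two
points on the line and at least one off it. Lines bent at points of that line cut the set into
pieces with exactly the allotted numbers of points on, above and below it (`exists_cut_family`). If
every line carries fewer than `2 * l` points, a supporting line through two points is used to cut
off one polygon in its own convex hull. The size `L j ≥ 4` is kept for the remainder, which then has
at least `3 * (l - 1) + 1` points; this is exactly enough for (b) to hold again, as `(2 * l - 1) +
(l - 1) = 3 * (l - 1) + 1`.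

Each piece spans a simple polygon by `polygonal_doubleHull`. The extreme points `p`, `q` of the
piece on the line are joined by two chains, one on each side, each ordered by angle from a viewpoint
just across the line. The polygon stays in the union of the hulls of the two sides, and bent lines
separate such unions although they need not separate convex hulls. -/

namespace PolygonPartition

open Filter Topology

/-! ### Enclosed regions, separated chains and simplicity. -/

/-- A star convex set containing the boundary of a polygon contains its closed region. -/
theorem closedRegion_subset {n : ℕ} (C : Polygon Plane n) {K : Set Plane} {z : Plane} (hz : z ∈ K)
    (hK : StarConvex ℝ z K) (hC : C.boundary ℝ ⊆ K) : closedRegion C ⊆ K := by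
  rintro w (hw | ⟨-, hb⟩)
  · exact hC hw
  by_contra hwK
  have hne : w ≠ z := fun h => hwK (h ▸ hz)
  -- The ray from `w` away from `z`: if it met `K`, star convexity would put `w` in `K`. It
  -- therefore avoids the boundary and makes the component of `w` unbounded.
  set r : ℝ → Plane := fun t => w + t • (w - z) with hr
  have hray : r '' Set.Ici 0 ⊆ (C.boundary ℝ)ᶜ := by
    rintro _ ⟨t, ht, rfl⟩ hmem
    have ht : 0 ≤ t := ht
    have h := hK (hC hmem) (a := t / (1 + t)) (b := 1 / (1 + t)) (by positivity) (by positivity)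
      (by field_simp; ring)
    apply hwK
    convert h using 1
    have h1 : (1 + t) ≠ 0 := by positivity
    have : (1 + t) • w = t • z + r t := by simp only [hr]; module
    calc w = (1 + t)⁻¹ • ((1 + t) • w) := by rw [smul_smul, inv_mul_cancel₀ h1, one_smul]
      _ = _ := by rw [this, smul_add, smul_smul]; congr 2 <;> ring
  have hpre : IsPreconnected (r '' Set.Ici 0) :=
    isPreconnected_Ici.image _ (by fun_prop)
  have hsub := hpre.subset_connectedComponentIn (x := w) ⟨0, by simp, by simp [hr]⟩ hray
  obtain ⟨M, hM⟩ := (hb.subset hsub).exists_norm_le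
  have hpos : 0 < ‖w - z‖ := norm_pos_iff.2 (sub_ne_zero.2 hne)
  have hM0 : 0 ≤ M := (norm_nonneg _).trans (hM _ ⟨0, by simp, rfl⟩)
  set t := (M + ‖w‖ + 1) / ‖w - z‖ with ht
  have ht0 : 0 ≤ t := by positivity
  have h1 := hM (r t) ⟨t, ht0, rfl⟩
  have h2 : ‖t • (w - z)‖ ≤ ‖r t‖ + ‖w‖ := by
    have : t • (w - z) = r t - w := by simp [hr]
    rw [this]; exact norm_sub_le _ _
  rw [norm_smul, Real.norm_of_nonneg ht0, ht, div_mul_cancel₀ _ hpos.ne'] at h2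
  linarith

theorem eq_right_of_mem_segment (g : Plane →ᵃ[ℝ] ℝ) {u v z : Plane} (hu : g u < 0) (hv : g v = 0)
    (hz : z ∈ segment ℝ u v) (h0 : 0 ≤ g z) : z = v := by
  obtain ⟨a, b, ha, hb, hab, rfl⟩ := hz
  rw [Convex.combo_affine_apply hab, hv, smul_zero, add_zero, smul_eq_mul] at h0
  have ha0 : a = 0 := by nlinarith
  have hb1 : b = 1 := by linarith
  simp [ha0, hb1]

theorem eq_left_of_mem_segment (g : Plane →ᵃ[ℝ] ℝ) {u v z : Plane} (hu : g u = 0) (hv : 0 < g v)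
    (hz : z ∈ segment ℝ u v) (h0 : g z ≤ 0) : z = u := by
  rw [segment_symm] at hz
  exact eq_right_of_mem_segment (-g) (by simpa using hv) (by simpa using hu) hz (by simpa using h0)

theorem convex_affine_lt (g : Plane →ᵃ[ℝ] ℝ) (c : ℝ) : Convex ℝ {z | g z < c} :=
  (convex_Iio c).affine_preimage g

theorem convex_affine_le (g : Plane →ᵃ[ℝ] ℝ) (c : ℝ) : Convex ℝ {z | g z ≤ c} :=
  (convex_Iic c).affine_preimage g

theorem convex_affine_gt (g : Plane →ᵃ[ℝ] ℝ) (c : ℝ) : Convex ℝ {z | c < g z} :=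
  (convex_Ioi c).affine_preimage g

theorem convex_affine_ge (g : Plane →ᵃ[ℝ] ℝ) (c : ℝ) : Convex ℝ {z | c ≤ g z} :=
  (convex_Ici c).affine_preimage g

/-- A polygonal chain `W 0, …, W m` such that through every inner vertex there is a line strictly
separating the earlier vertices from the later ones. -/
def SepChain (m : ℕ) (W : ℕ → Plane) : Prop :=
  ∀ i, 0 < i → i < m → ∃ g : Plane →ᵃ[ℝ] ℝ, g (W i) = 0 ∧ (∀ k < i, g (W k) < 0) ∧
    ∀ k, i < k → k ≤ m → 0 < g (W k)

/-- The separating line at `W (i + 1)` has edge `i` on one side and all later edges on the other;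
only edge `i + 1` can touch it, and only at `W (i + 1)`. -/
theorem SepChain.eq_of_mem {m : ℕ} {W : ℕ → Plane} (hW : SepChain m W) {i j : ℕ} (hij : i < j)
    (hj : j < m) {z : Plane} (hi : z ∈ segment ℝ (W i) (W (i + 1)))
    (hz : z ∈ segment ℝ (W j) (W (j + 1))) : j = i + 1 ∧ z = W j := by
  obtain ⟨g, h0, hlt, hgt⟩ := hW (i + 1) (by omega) (by omega)
  have hz1 : g z ≤ 0 := (convex_affine_le g 0).segment_subset (hlt i (by omega)).le h0.le hi
  rcases Nat.lt_or_ge (i + 1) j with h | h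
  · have : 0 < g z :=
      (convex_affine_gt g 0).segment_subset (hgt j h hj.le) (hgt (j + 1) (by omega) (by omega)) hz
    linarith
  · obtain rfl : j = i + 1 := by omega
    exact ⟨rfl, eq_left_of_mem_segment g h0 (hgt _ (by omega) (by omega)) hz hz1⟩

theorem SepChain.eq_zero_of_first_mem {m : ℕ} {W : ℕ → Plane} (hW : SepChain m W) {i : ℕ}
    (hi : i < m) (h : W 0 ∈ segment ℝ (W i) (W (i + 1))) : i = 0 := by
  by_contra hi0
  obtain ⟨g, h0, hlt, hgt⟩ := hW i (by omega) hi
  have : 0 ≤ g (W 0) :=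
    (convex_affine_ge g 0).segment_subset h0.ge (hgt (i + 1) (by omega) (by omega)).le h
  linarith [hlt 0 (by omega)]

theorem SepChain.eq_of_last_mem {m : ℕ} {W : ℕ → Plane} (hW : SepChain m W) {i : ℕ}
    (hi : i < m) (h : W m ∈ segment ℝ (W i) (W (i + 1))) : i + 1 = m := by
  by_contra hi0
  obtain ⟨g, h0, hlt, hgt⟩ := hW (i + 1) (by omega) (by omega)
  have : g (W m) ≤ 0 :=
    (convex_affine_le g 0).segment_subset (hlt i (by omega)).le h0.le h
  linarith [hgt m (by omega) (by omega)]

theorem val_finRotate {n : ℕ} (i : Fin n) :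
    (finRotate n i : ℕ) = (if (i : ℕ) + 1 = n then 0 else (i : ℕ) + 1 : ℕ) := by
  obtain ⟨m, rfl⟩ := Nat.exists_eq_succ_of_ne_zero (Fin.pos i).ne'
  rw [coe_finRotate]
  simp [Fin.ext_iff]

/-- A criterion for simplicity, for a polygon given by a sequence indexed by natural numbers. -/
theorem isSimple_of_nat {n : ℕ} (hn : 3 ≤ n) (V : ℕ → Plane) (hV : V n = V 0)
    (hinj : Function.Injective fun i : Fin n => V i)
    (h : ∀ i j, i < j → j < n → ∀ z ∈ segment ℝ (V i) (V (i + 1)),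
      z ∈ segment ℝ (V j) (V (j + 1)) → (j = i + 1 ∧ z = V j) ∨ (i = 0 ∧ j + 1 = n ∧ z = V 0)) :
    IsSimple (⟨fun i : Fin n => V i⟩ : Polygon Plane n) := by
  set C : Polygon Plane n := ⟨fun i : Fin n => V i⟩ with hC
  have hrot : ∀ i : Fin n, V (finRotate n i) = V (i + 1) := by
    intro i
    rw [val_finRotate]
    split_ifs with h1
    · rw [h1, hV]
    · rfl
  have hedge : ∀ i : Fin n, C.edgeSet ℝ i = segment ℝ (V i) (V (i + 1)) := by
    intro i
    rw [← hrot, ← affineSegment_eq_segment]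
    rfl
  refine ⟨hn, hinj, ?_, ?_⟩
  · intro i
    have hCi : C (finRotate n i) = V (i + 1) := hrot i
    rw [hedge, hedge, hCi, hrot]
    apply Set.Subset.antisymm
    · rintro z ⟨h1, h2⟩
      rw [val_finRotate] at h2
      split_ifs at h2 with h3
      · rw [h3, hV] at h2
        rcases h 0 i (by omega) i.2 z h2 h1 with h4 | h4
        · omega
        · rw [h3, hV]; exact h4.2.2
      · rcases h i (i + 1) (by omega) (by omega) z h1 h2 with h4 | h4
        · exact h4.2
        · omega
    · rintro _ rfl
      exact ⟨right_mem_segment _ _ _, left_mem_segment _ _ _⟩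
  · have key : ∀ i j : Fin n, i < j → j ≠ finRotate n i → i ≠ finRotate n j →
        Disjoint (C.edgeSet ℝ i) (C.edgeSet ℝ j) := by
      intro i j hij h1 h2
      rw [Ne, Fin.ext_iff, val_finRotate] at h1 h2
      rw [hedge, hedge, Set.disjoint_left]
      intro z hz1 hz2
      rcases h i j hij j.2 z hz1 hz2 with h3 | h3
      · rw [if_neg (by omega)] at h1
        exact h1 h3.1
      · rw [if_pos h3.2.1] at h2
        exact h2 h3.1
    intro i j hij h1 h2
    rcases lt_or_gt_of_ne hij with h3 | h3
    · exact key i j h3 h1 h2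
    · exact (key j i h3 h2 h1).symm

/-! ### Ordering a finite set into a separated chain. -/

/-- A finite set on which `κ` is injective can be listed in increasing order of `κ`. -/
theorem exists_enum {α : Type*} [Nonempty α] (S : Finset α) (κ : α → ℝ) (hκ : Set.InjOn κ S) :
    ∃ W : ℕ → α, (∀ i < S.card, W i ∈ S) ∧ (∀ w ∈ S, ∃ i < S.card, W i = w) ∧
      ∀ i j, i < j → j < S.card → κ (W i) < κ (W j) := by
  classical
  have hc : (S.image κ).card = S.card := Finset.card_image_of_injOn hκ
  set e := (S.image κ).orderEmbOfFin hc with he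
  have h1 : ∀ i : Fin S.card, ∃ w ∈ S, κ w = e i := fun i =>
    Finset.mem_image.1 (Finset.orderEmbOfFin_mem _ hc i)
  choose f hf hκf using h1
  refine ⟨fun i => if h : i < S.card then f ⟨i, h⟩ else Classical.arbitrary α, ?_, ?_, ?_⟩
  · intro i hi
    simp only [hi, dif_pos]
    exact hf _
  · intro w hw
    have h2 : κ w ∈ Set.range e := by
      rw [he, Finset.range_orderEmbOfFin]
      exact Finset.mem_coe.2 (Finset.mem_image_of_mem _ hw)
    obtain ⟨i, hi⟩ := h2
    refine ⟨i, i.2, ?_⟩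
    simp only [i.2, dif_pos]
    exact hκ (hf _) hw (by rw [hκf, hi])
  · intro i j hij hj
    simp only [hj, hij.trans hj, dif_pos, hκf]
    exact e.strictMono hij

theorem eventually_mul_ne {a : ℝ} (ha : a ≠ 0) (b c : ℝ) : ∀ᶠ t in 𝓝[>] c, a * t ≠ b := by
  have h : ∀ᶠ t in 𝓝[>] c, t ≠ b / a := by
    rcases le_or_gt (b / a) c with h | h
    · filter_upwards [self_mem_nhdsWithin] with t ht
      exact (lt_of_le_of_lt h ht).ne'
    · filter_upwards [Ioo_mem_nhdsGT h] with t ht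
      exact ht.2.ne
  filter_upwards [h] with t ht h1
  exact ht (by rw [← h1, mul_div_cancel_left₀ _ ha])

/-- A finite set of points in a closed half plane can be ordered to a chain that starts and ends in
the extreme points on the boundary of the half plane. -/
theorem exists_sepChain (x y : Plane →ᵃ[ℝ] ℝ) (hxy : ∀ u v, x u = x v → y u = y v → u = v)
    (S : Finset Plane) {p q : Plane} (hp : p ∈ S) (hq : q ∈ S) (yp : y p = 0) (yq : y q = 0)
    (hpq : x p < x q) (hS : ∀ w ∈ S, y w ≤ 0 ∧ (y w = 0 → x p ≤ x w ∧ x w ≤ x q))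
    {m : ℕ} (hm : S.card = m + 1) :
    ∃ W : ℕ → Plane, SepChain m W ∧ W 0 = p ∧ W m = q ∧ (∀ i ≤ m, W i ∈ S) ∧
      (∀ w ∈ S, ∃ i ≤ m, W i = w) := by
  classical
  -- The viewpoint will be the point with coordinates `(c, ε)`. Since no point of `S` has `x = c`,
  -- points with equal `x` are still seen in different directions.
  obtain ⟨c, ⟨hpc, hcq⟩, hc⟩ := (Set.Ioo_infinite hpq).exists_notMem_finset (S.image x)
  have hc' : ∀ w ∈ S, x w ≠ c := fun w hw h => hc (Finset.mem_image.2 ⟨w, hw, h⟩)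
  have hinj : ∀ᶠ ε in 𝓝[>] (0 : ℝ), ∀ u ∈ S, ∀ v ∈ S, u ≠ v →
      (x u - c) * (ε - y v) ≠ (x v - c) * (ε - y u) := by
    refine (eventually_all_finset S).2 fun u hu => (eventually_all_finset S).2 fun v hv => ?_
    by_cases huv : u = v
    · simp [huv]
    by_cases hx : x u = x v
    · refine Eventually.of_forall fun ε _ h => ?_
      rw [hx] at h
      have := mul_left_cancel₀ (sub_ne_zero.2 (hc' v hv)) h
      exact huv (hxy u v hx (by linarith))
    · filter_upwards [eventually_mul_ne (sub_ne_zero.2 hx)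
        ((x u - c) * y v - (x v - c) * y u) 0] with ε hε _ h
      exact hε (by linarith)
  have hcont : ∀ {f g : ℝ → ℝ}, Continuous f → Continuous g → f 0 < g 0 →
      ∀ᶠ ε in 𝓝[>] (0 : ℝ), f ε < g ε := fun hf hg h =>
    eventually_nhdsWithin_of_eventually_nhds
      ((hf.tendsto 0).eventually_lt (hg.tendsto 0) h)
  -- As `ε` tends to `0`, `p` and `q` are seen in directions tending to the line itself, hence
  -- outside those of all points with `y < 0`; points on the line are seen in the order of `x`.
  have hfirst : ∀ᶠ ε in 𝓝[>] (0 : ℝ), ∀ w ∈ S, w ≠ p →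
      (x p - c) * (ε - y w) < (x w - c) * ε := by
    refine (eventually_all_finset S).2 fun w hw => ?_
    rcases (hS w hw).1.lt_or_eq with h | h
    · filter_upwards [hcont (f := fun ε => (x p - c) * (ε - y w)) (g := fun ε => (x w - c) * ε)
        (by fun_prop) (by fun_prop) (by simp; nlinarith)] with ε hε _ using hε
    · filter_upwards [self_mem_nhdsWithin] with ε hε hwp
      have hε : 0 < ε := hε
      have : x p < x w := lt_of_le_of_ne ((hS w hw).2 h).1
        fun h1 => hwp (hxy w p h1.symm (by rw [h, yp]))
      rw [h, sub_zero]
      exact mul_lt_mul_of_pos_right (by linarith) hε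
  have hlast : ∀ᶠ ε in 𝓝[>] (0 : ℝ), ∀ w ∈ S, w ≠ q →
      (x w - c) * ε < (x q - c) * (ε - y w) := by
    refine (eventually_all_finset S).2 fun w hw => ?_
    rcases (hS w hw).1.lt_or_eq with h | h
    · filter_upwards [hcont (f := fun ε => (x w - c) * ε) (g := fun ε => (x q - c) * (ε - y w))
        (by fun_prop) (by fun_prop) (by simp; nlinarith)] with ε hε _ using hε
    · filter_upwards [self_mem_nhdsWithin] with ε hε hwp
      have hε : 0 < ε := hε
      have : x w < x q := lt_of_le_of_ne ((hS w hw).2 h).2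
        fun h1 => hwp (hxy w q h1 (by rw [h, yq]))
      rw [h, sub_zero]
      exact mul_lt_mul_of_pos_right (by linarith) hε
  obtain ⟨ε, ⟨⟨h1, h2⟩, h3⟩, hε⟩ :=
    (((hinj.and hfirst).and hlast).and self_mem_nhdsWithin).exists
  have hε : 0 < ε := hε
  have hpos : ∀ w ∈ S, 0 < ε - y w := fun w hw => by linarith [(hS w hw).1]
  -- Up to sign, the inverse slope of the line from `(c, ε)` to `w`.
  set κ : Plane → ℝ := fun w => (x w - c) / (ε - y w) with hκ
  have hinjκ : Set.InjOn κ S := by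
    intro u hu v hv huv
    by_contra hne
    exact h1 u hu v hv hne ((div_eq_div_iff (hpos u hu).ne' (hpos v hv).ne').1 huv)
  obtain ⟨W, hWS, hSW, hmono⟩ := exists_enum S κ hinjκ
  rw [hm] at hWS hSW hmono
  have hκp : ∀ w ∈ S, w ≠ p → κ p < κ w := by
    intro w hw hwp
    simp only [hκ, yp, sub_zero]
    rw [div_lt_div_iff₀ hε (hpos w hw)]
    exact h2 w hw hwp
  have hκq : ∀ w ∈ S, w ≠ q → κ w < κ q := by
    intro w hw hwq
    simp only [hκ, yq, sub_zero]
    rw [div_lt_div_iff₀ (hpos w hw) hε]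
    exact h3 w hw hwq
  refine ⟨W, ?_, ?_, ?_, fun i hi => hWS i (by omega), fun w hw => ?_⟩
  · intro i hi0 him
    -- The separating function vanishes on the line through `(c, ε)` and `W i`; its sign at `W k` is
    -- that of `κ (W k) - κ (W i)`.
    have hg : ∀ k ≤ m, (x + κ (W i) • y - AffineMap.const ℝ Plane (c + κ (W i) * ε)) (W k)
        = (ε - y (W k)) * (κ (W k) - κ (W i)) := by
      intro k hk
      have := (hpos (W k) (hWS k (by omega))).ne'
      have h4 : (ε - y (W k)) * κ (W k) = x (W k) - c := by
        simp only [hκ]; field_simp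
      rw [mul_sub, h4]
      simp
      ring
    refine ⟨x + κ (W i) • y - AffineMap.const ℝ Plane (c + κ (W i) * ε), ?_, fun k hk => ?_,
      fun k hk hkm => ?_⟩
    · rw [hg i him.le, sub_self, mul_zero]
    · rw [hg k (by omega)]
      exact mul_neg_of_pos_of_neg (hpos _ (hWS k (by omega)))
        (sub_neg.2 (hmono k i hk (by omega)))
    · rw [hg k hkm]
      exact mul_pos (hpos _ (hWS k (by omega))) (sub_pos.2 (hmono i k hk (by omega)))
  · by_contra hne
    obtain ⟨i, hi, rfl⟩ := hSW p hp
    have h4 : 0 < i := Nat.pos_of_ne_zero fun h => hne (by rw [h])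
    linarith [hmono 0 i h4 hi, hκp _ (hWS 0 (by omega)) hne]
  · by_contra hne
    obtain ⟨i, hi, rfl⟩ := hSW q hq
    have h4 : i < m := lt_of_le_of_ne (by omega) fun h => hne (by rw [h])
    linarith [hmono i m h4 (by omega), hκq _ (hWS m (by omega)) hne]
  · obtain ⟨i, hi, h⟩ := hSW w hw
    exact ⟨i, by omega, h⟩

/-! ### Simple polygons from two chains on either side of a line. -/

/-- The union of the convex hulls of the two parts into which the line `y = 0` cuts a finite set. -/
def doubleHull (y : Plane →ᵃ[ℝ] ℝ) (S : Finset Plane) : Set Plane :=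
  convexHull ℝ {w | w ∈ S ∧ 0 ≤ y w} ∪ convexHull ℝ {w | w ∈ S ∧ y w ≤ 0}

theorem doubleHull_subset (y : Plane →ᵃ[ℝ] ℝ) (S : Finset Plane) :
    doubleHull y S ⊆ convexHull ℝ (S : Set Plane) :=
  Set.union_subset (convexHull_mono fun _ h => h.1) (convexHull_mono fun _ h => h.1)

theorem doubleHull_neg (y : Plane →ᵃ[ℝ] ℝ) (S : Finset Plane) :
    doubleHull (-y) S = doubleHull y S := by
  simp only [doubleHull, AffineMap.coe_neg, Pi.neg_apply, Left.nonneg_neg_iff,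
    Left.neg_nonpos_iff]
  rw [Set.union_comm]

/-- The points of `S` are the vertices of a simple polygon that encloses no point outside `R`. -/
def Polygonal (S : Finset Plane) (R : Set Plane) : Prop :=
  ∃ C : Polygon Plane S.card, IsSimple C ∧ Set.range C.vertices = S ∧ closedRegion C ⊆ R

theorem mem_of_mem_segment_of_nonneg (y : Plane →ᵃ[ℝ] ℝ) {u v z : Plane} (hu : 0 ≤ y u)
    (hv : 0 ≤ y v) (huv : 0 < y u ∨ 0 < y v) (hz : z ∈ segment ℝ u v) (h0 : y z ≤ 0) :
    (z = u ∧ y u = 0) ∨ (z = v ∧ y v = 0) := by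
  rcases hu.lt_or_eq with h1 | h1
  · rcases hv.lt_or_eq with h2 | h2
    · have : 0 < y z := (convex_affine_gt y 0).segment_subset h1 h2 hz
      linarith
    · rw [segment_symm] at hz
      exact Or.inr ⟨eq_left_of_mem_segment y h2.symm h1 hz h0, h2.symm⟩
  · exact Or.inl ⟨eq_left_of_mem_segment y h1.symm (by rcases huv with h | h <;> linarith) hz h0,
      h1.symm⟩

/-- A lower chain from `p` to `q` takes all points with `y ≤ 0`, and an upper chain from `q` back to
`p` takes the points with `y > 0`. A point above is required so that the upper chain does not run
back along the line. -/
theorem polygonal_of_exists_pos (x y : Plane →ᵃ[ℝ] ℝ) (hxy : ∀ u v, x u = x v → y u = y v → u = v)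
    (S : Finset Plane) (h2 : 2 ≤ (S.filter (y · = 0)).card) (h1 : ∃ a ∈ S, 0 < y a) :
    Polygonal S (doubleHull y S) := by
  classical
  set J := S.filter (y · = 0) with hJ
  have hJmem : ∀ {w}, w ∈ J ↔ w ∈ S ∧ y w = 0 := by simp [hJ]
  have hJne : J.Nonempty := Finset.card_pos.1 (by omega)
  obtain ⟨p, hpJ, hpmin⟩ := J.exists_min_image x hJne
  obtain ⟨q, hqJ, hqmax⟩ := J.exists_max_image x hJne
  obtain ⟨hpS, yp⟩ := hJmem.1 hpJ
  obtain ⟨hqS, yq⟩ := hJmem.1 hqJ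
  have hpq : x p < x q := by
    refine lt_of_le_of_ne (hqmax p hpJ) fun h => ?_
    have : J.card ≤ 1 := Finset.card_le_one.2 fun u hu v hv => hxy u v
      (by linarith [hpmin u hu, hqmax u hu, hpmin v hv, hqmax v hv])
      ((hJmem.1 hu).2.trans (hJmem.1 hv).2.symm)
    omega
  have hpq' : p ≠ q := fun h => hpq.ne (by rw [h])
  set A := S.filter (0 < y ·) with hA
  have hAmem : ∀ {w}, w ∈ A ↔ w ∈ S ∧ 0 < y w := by simp [hA]
  set S₁ := S.filter (¬ 0 < y ·) with hS₁
  have hS₁mem : ∀ {w}, w ∈ S₁ ↔ w ∈ S ∧ y w ≤ 0 := by simp [hS₁]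
  set S₂ := insert q (insert p A) with hS₂
  have hS₂mem : ∀ {w}, w ∈ S₂ ↔ w = q ∨ w = p ∨ w ∈ S ∧ 0 < y w := by simp [hS₂, hAmem]
  have hS₂S : ∀ w ∈ S₂, w ∈ S ∧ 0 ≤ y w := by
    intro w hw
    rcases hS₂mem.1 hw with rfl | rfl | h
    · exact ⟨hqS, yq.ge⟩
    · exact ⟨hpS, yp.ge⟩
    · exact ⟨h.1, h.2.le⟩
  have hAc : 1 ≤ A.card := by
    obtain ⟨a, ha, hay⟩ := h1
    exact Finset.card_pos.2 ⟨a, hAmem.2 ⟨ha, hay⟩⟩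
  have hS₂c : S₂.card = A.card + 2 := by
    rw [hS₂, Finset.card_insert_of_notMem, Finset.card_insert_of_notMem]
    · intro h; linarith [(hAmem.1 h).2]
    · rw [Finset.mem_insert, not_or]
      exact ⟨hpq'.symm, fun h => by linarith [(hAmem.1 h).2]⟩
  have hS₁c : 2 ≤ S₁.card := h2.trans (Finset.card_le_card fun w hw =>
    hS₁mem.2 ⟨(hJmem.1 hw).1, (hJmem.1 hw).2.le⟩)
  have hSc : A.card + S₁.card = S.card := Finset.card_filter_add_card_filter_not _
  obtain ⟨m₁, hm₁⟩ : ∃ m, S₁.card = m + 1 := ⟨S₁.card - 1, by omega⟩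
  obtain ⟨W₁, hW₁, hW₁0, hW₁m, hW₁S, hSW₁⟩ := exists_sepChain x y hxy S₁
    (hS₁mem.2 ⟨hpS, yp.le⟩) (hS₁mem.2 ⟨hqS, yq.le⟩) yp yq hpq
    (fun w hw => ⟨(hS₁mem.1 hw).2, fun h =>
      ⟨hpmin w (hJmem.2 ⟨(hS₁mem.1 hw).1, h⟩), hqmax w (hJmem.2 ⟨(hS₁mem.1 hw).1, h⟩)⟩⟩) hm₁
  set m₂ := A.card + 1 with hm₂
  obtain ⟨W₂, hW₂, hW₂0, hW₂m, hW₂S, hSW₂⟩ := exists_sepChain (-x) (-y)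
    (fun u v h h' => hxy u v (by simpa using h) (by simpa using h')) S₂
    (p := q) (q := p) (m := m₂) (by simp [hS₂]) (by simp [hS₂]) (by simpa using yq)
    (by simpa using yp) (by simpa using hpq)
    (fun w hw => by
      have h := hS₂S w hw
      refine ⟨by simpa using h.2, fun h' => ?_⟩
      have h' : y w = 0 := by simpa using h'
      have h3 := hpmin w (hJmem.2 ⟨h.1, h'⟩)
      have h4 := hqmax w (hJmem.2 ⟨h.1, h'⟩)
      simpa using ⟨h4, h3⟩) (by omega)
  have hn : S.card = m₁ + m₂ := by omega
  -- The two chains share `q` at index `m₁` and `p` at the indices `0` and `m₁ + m₂`.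
  set V : ℕ → Plane := fun i => if i ≤ m₁ then W₁ i else W₂ (i - m₁) with hV
  have hV₁ : ∀ i ≤ m₁, V i = W₁ i := fun i hi => by simp [hV, hi]
  have hV₂ : ∀ i, V (m₁ + i) = W₂ i := by
    intro i
    rcases Nat.eq_zero_or_pos i with rfl | hi
    · rw [add_zero, hV₁ _ le_rfl, hW₁m, hW₂0]
    · simp only [hV, add_tsub_cancel_left]
      rw [if_neg (by omega)]
  have hVn : V S.card = V 0 := by rw [hn, hV₂, hV₁ 0 (by omega), hW₂m, hW₁0]
  have hVS : ∀ i ≤ S.card, V i ∈ S := by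
    intro i hi
    rcases le_or_gt i m₁ with h | h
    · rw [hV₁ i h]; exact (hS₁mem.1 (hW₁S i h)).1
    · obtain ⟨k, rfl⟩ := Nat.exists_eq_add_of_le h.le
      rw [hV₂]; exact (hS₂S _ (hW₂S k (by omega))).1
  have hrange : Set.range (fun i : Fin S.card => V i) = S := by
    apply Set.Subset.antisymm
    · rintro _ ⟨i, rfl⟩
      exact hVS i i.2.le
    · intro w hw
      have hw : w ∈ S := hw
      by_cases h : 0 < y w
      · obtain ⟨k, hk, rfl⟩ := hSW₂ w (hS₂mem.2 (Or.inr (Or.inr ⟨hw, h⟩)))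
        have hk' : k < m₂ := lt_of_le_of_ne hk fun h' => by rw [h', hW₂m] at h; linarith
        exact ⟨⟨m₁ + k, by omega⟩, hV₂ k⟩
      · obtain ⟨k, hk, rfl⟩ := hSW₁ w (hS₁mem.2 ⟨hw, not_lt.1 h⟩)
        exact ⟨⟨k, by omega⟩, hV₁ k hk⟩
  have hinj : Function.Injective (fun i : Fin S.card => V i) := by
    have h3 : Finset.univ.image (fun i : Fin S.card => V i) = S := by
      apply Finset.coe_injective
      rw [Finset.coe_image, Finset.coe_univ, Set.image_univ, hrange]
    have h4 : (Finset.univ.image (fun i : Fin S.card => V i)).card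
        = (Finset.univ : Finset (Fin S.card)).card := by rw [h3, Finset.card_fin]
    exact Set.injOn_univ.1 (by simpa using Finset.card_image_iff.1 h4)
  have hedge₁ : ∀ i < m₁, segment ℝ (V i) (V (i + 1)) = segment ℝ (W₁ i) (W₁ (i + 1)) := by
    intro i hi
    rw [hV₁ i hi.le, hV₁ (i + 1) hi]
  have hedge₂ : ∀ i, segment ℝ (V (m₁ + i)) (V (m₁ + i + 1)) = segment ℝ (W₂ i) (W₂ (i + 1)) := by
    intro i
    rw [hV₂ i, add_assoc, hV₂ (i + 1)]
  have hcross : ∀ i < m₁, ∀ k < m₂, ∀ z ∈ segment ℝ (W₁ i) (W₁ (i + 1)),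
      z ∈ segment ℝ (W₂ k) (W₂ (k + 1)) → z = p ∨ z = q := by
    intro i hi k hk z hz₁ hz₂
    have hy : y z ≤ 0 := (convex_affine_le y 0).segment_subset
      (hS₁mem.1 (hW₁S i hi.le)).2 (hS₁mem.1 (hW₁S (i + 1) hi)).2 hz₁
    have hends : ∀ k ≤ m₂, y (W₂ k) = 0 → W₂ k = p ∨ W₂ k = q := by
      intro k hk h
      rcases hS₂mem.1 (hW₂S k hk) with h' | h' | h'
      · exact Or.inr h'
      · exact Or.inl h'
      · linarith [h'.2]
    -- Otherwise both ends of the edge would be among `p`, `q`. Since `m₂ ≥ 2`, one of them is an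
    -- inner vertex of the chain, and its separating line keeps it distinct from both chain ends.
    have hposs : 0 < y (W₂ k) ∨ 0 < y (W₂ (k + 1)) := by
      by_contra! hcon
      rw [← hW₂0, ← hW₂m] at hends
      rcases Nat.eq_zero_or_pos k with rfl | hk0
      · obtain ⟨g, h0, hlt, hgt⟩ := hW₂ 1 (by omega) (by omega)
        rcases hends 1 (by omega)
          (le_antisymm hcon.2 (hS₂S _ (hW₂S _ (by omega))).2) with h | h
        · have := hgt m₂ (by omega) le_rfl
          rw [← h] at this; linarith
        · have := hlt 0 (by omega)
          rw [← h] at this; linarith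
      · obtain ⟨g, h0, hlt, hgt⟩ := hW₂ k hk0 hk
        rcases hends k hk.le
          (le_antisymm hcon.1 (hS₂S _ (hW₂S _ (by omega))).2) with h | h
        · have := hgt m₂ hk le_rfl
          rw [← h] at this; linarith
        · have := hlt 0 hk0
          rw [← h] at this; linarith
    rcases mem_of_mem_segment_of_nonneg y (hS₂S _ (hW₂S k hk.le)).2
      (hS₂S _ (hW₂S (k + 1) hk)).2 hposs hz₂ hy with h | h
    · rw [h.1]; exact hends k hk.le h.2
    · rw [h.1]; exact hends (k + 1) hk h.2
  refine ⟨⟨fun i => V i⟩, isSimple_of_nat (by omega) V hVn hinj ?_, hrange, ?_⟩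
  · intro i j hij hj z hzi hzj
    rcases Nat.lt_or_ge j m₁ with hjm | hjm
    · rw [hedge₁ i (by omega)] at hzi
      rw [hedge₁ j hjm] at hzj
      rw [hV₁ j hjm.le]
      exact Or.inl (hW₁.eq_of_mem hij hjm hzi hzj)
    obtain ⟨k, rfl⟩ := Nat.exists_eq_add_of_le hjm
    rw [hedge₂] at hzj
    rcases Nat.lt_or_ge i m₁ with him | him
    · rw [hedge₁ i him] at hzi
      rcases hcross i him k (by omega) z hzi hzj with rfl | rfl
      · right
        rw [← hW₁0] at hzi
        rw [← hW₂m] at hzj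
        have h3 := hW₁.eq_zero_of_first_mem him hzi
        have h4 := hW₂.eq_of_last_mem (by omega) hzj
        exact ⟨h3, by omega, by rw [hV₁ 0 (by omega), hW₁0]⟩
      · left
        rw [← hW₁m] at hzi
        rw [← hW₂0] at hzj
        have h3 := hW₁.eq_of_last_mem him hzi
        have h4 := hW₂.eq_zero_of_first_mem (by omega) hzj
        exact ⟨by omega, by rw [hV₂, h4, hW₂0]⟩
    · obtain ⟨k', rfl⟩ := Nat.exists_eq_add_of_le him
      rw [hedge₂] at hzi
      have h3 := hW₂.eq_of_mem (by omega) (by omega) hzi hzj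
      exact Or.inl ⟨by omega, by rw [hV₂, h3.2]⟩
  · have hup : ∀ w ∈ S, 0 ≤ y w → w ∈ convexHull ℝ {w | w ∈ S ∧ 0 ≤ y w} :=
      fun w hw h => subset_convexHull ℝ _ (show w ∈ {w | w ∈ S ∧ 0 ≤ y w} from ⟨hw, h⟩)
    have hlow : ∀ w ∈ S, y w ≤ 0 → w ∈ convexHull ℝ {w | w ∈ S ∧ y w ≤ 0} :=
      fun w hw h => subset_convexHull ℝ _ (show w ∈ {w | w ∈ S ∧ y w ≤ 0} from ⟨hw, h⟩)
    -- As `p` lies on the line, it belongs to both hulls, so their union is star convex about it.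
    have hstar : StarConvex ℝ p (doubleHull y S) :=
      ((convex_convexHull ℝ _).starConvex (hup p hpS yp.ge)).union
        ((convex_convexHull ℝ _).starConvex (hlow p hpS yp.le))
    refine closedRegion_subset _ (Or.inl (hup p hpS yp.ge)) hstar ?_
    refine Set.iUnion_subset fun i => ?_
    have h3 : (⟨fun i : Fin S.card => V i⟩ : Polygon Plane S.card).edgeSet ℝ i
        = segment ℝ (V i) (V (i + 1)) := by
      have : V (finRotate _ i) = V (i + 1) := by
        rw [val_finRotate]
        split_ifs with h
        · rw [h, hVn]
        · rfl
      rw [← this, ← affineSegment_eq_segment]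
      rfl
    rw [h3]
    rcases Nat.lt_or_ge i m₁ with him | him
    · rw [hedge₁ _ him]
      exact ((convex_convexHull ℝ _).segment_subset
        (hlow _ (hS₁mem.1 (hW₁S i him.le)).1 (hS₁mem.1 (hW₁S i him.le)).2)
        (hlow _ (hS₁mem.1 (hW₁S (i + 1) him)).1 (hS₁mem.1 (hW₁S (i + 1) him)).2)).trans
        Set.subset_union_right
    · obtain ⟨k, hk⟩ := Nat.exists_eq_add_of_le him
      rw [hk, hedge₂]
      exact ((convex_convexHull ℝ _).segment_subset
        (hup _ (hS₂S _ (hW₂S k (by omega))).1 (hS₂S _ (hW₂S k (by omega))).2)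
        (hup _ (hS₂S _ (hW₂S (k + 1) (by omega))).1
          (hS₂S _ (hW₂S (k + 1) (by omega))).2)).trans Set.subset_union_left

/-- A finite set with at least two points on a line and at least one off it is the vertex set of a
simple polygon that stays in the union of the convex hulls of the two parts of the set. -/
theorem polygonal_doubleHull (x y : Plane →ᵃ[ℝ] ℝ) (hxy : ∀ u v, x u = x v → y u = y v → u = v)
    (S : Finset Plane) (h2 : 2 ≤ (S.filter (y · = 0)).card) (h1 : ∃ a ∈ S, y a ≠ 0) :
    Polygonal S (doubleHull y S) := by
  obtain ⟨a, ha, hay⟩ := h1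
  rcases lt_or_gt_of_ne hay with h | h
  · rw [← doubleHull_neg]
    exact polygonal_of_exists_pos x (-y) (fun u v h h' => hxy u v h (by simpa using h')) S
      (by simpa using h2) ⟨a, ha, by simpa using h⟩
  · exact polygonal_of_exists_pos x y hxy S h2 ⟨a, ha, h⟩

/-! ### Cutting a finite set by bent lines. -/

theorem exists_threshold {α : Type*} [DecidableEq α] [Nonempty α] (S : Finset α) (f : α → ℝ)
    (hf : Set.InjOn f S) {m : ℕ} (hm : m ≤ S.card) :
    ∃ T ⊆ S, T.card = m ∧ ∃ t, (∀ u ∈ T, f u < t) ∧ ∀ u ∈ S, u ∉ T → t < f u := by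
  obtain ⟨W, hWS, hSW, hmono⟩ := exists_enum S f hf
  have hinj : Set.InjOn W (Finset.range m) := by
    intro i hi j hj h
    have hi : i < m := Finset.mem_range.1 hi
    have hj : j < m := Finset.mem_range.1 hj
    rcases lt_trichotomy i j with h1 | h1 | h1
    · exact absurd (congrArg f h) (hmono i j h1 (by omega)).ne
    · exact h1
    · exact absurd (congrArg f h) (hmono j i h1 (by omega)).ne'
  set T := (Finset.range m).image W with hT
  have hlt : ∀ a ∈ T.image f, ∀ b ∈ (S \ T).image f, a < b := by
    intro a ha b hb
    obtain ⟨u, hu, rfl⟩ := Finset.mem_image.1 ha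
    obtain ⟨v, hv, rfl⟩ := Finset.mem_image.1 hb
    obtain ⟨i, hi, rfl⟩ := Finset.mem_image.1 hu
    obtain ⟨hvS, hvT⟩ := Finset.mem_sdiff.1 hv
    obtain ⟨j, hj, rfl⟩ := hSW v hvS
    have hi : i < m := Finset.mem_range.1 hi
    have hj' : m ≤ j := not_lt.1 fun h =>
      hvT (Finset.mem_image_of_mem W (Finset.mem_range.2 h))
    exact hmono i j (by omega) hj
  obtain ⟨t, h1, h2⟩ := Order.exists_between_finsets _ _ hlt
  refine ⟨T, ?_, ?_, t, fun u hu => h1 _ (Finset.mem_image_of_mem f hu), fun u hu hu' =>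
    h2 _ (Finset.mem_image_of_mem f (Finset.mem_sdiff.2 ⟨hu, hu'⟩))⟩
  · intro u hu
    obtain ⟨i, hi, rfl⟩ := Finset.mem_image.1 hu
    exact hWS i (lt_of_lt_of_le (Finset.mem_range.1 hi) hm)
  · rw [hT, Finset.card_image_of_injOn hinj, Finset.card_range]

/-- The piecewise affine function vanishing on the two rays that emanate from the point with
coordinates `(c, 0)` and have inverse slopes `t` above and `t'` below the line `y = 0`. -/
noncomputable def bentFun (x y : Plane →ᵃ[ℝ] ℝ) (c t t' : ℝ) (w : Plane) : ℝ :=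
  x w - c - t * max (y w) 0 - t' * min (y w) 0

theorem bentFun_of_nonneg (x y : Plane →ᵃ[ℝ] ℝ) (c t t' : ℝ) {w : Plane} (h : 0 ≤ y w) :
    bentFun x y c t t' w = (x - t • y) w - c := by
  simp [bentFun, h]
  ring

theorem bentFun_of_nonpos (x y : Plane →ᵃ[ℝ] ℝ) (c t t' : ℝ) {w : Plane} (h : y w ≤ 0) :
    bentFun x y c t t' w = (x - t' • y) w - c := by
  simp [bentFun, h]
  ring

/-- `S` lies on the left and `T` on the right of a line bent at a point with `y = 0`. -/
def Cut (x y : Plane →ᵃ[ℝ] ℝ) (S T : Finset Plane) : Prop :=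
  ∃ c t t', (∀ u ∈ S, bentFun x y c t t' u < 0) ∧ ∀ u ∈ T, 0 < bentFun x y c t t' u

theorem Cut.mono {x y : Plane →ᵃ[ℝ] ℝ} {S T T' : Finset Plane} (h : Cut x y S T) (hT : T' ⊆ T) :
    Cut x y S T' := by
  obtain ⟨c, t, t', h1, h2⟩ := h
  exact ⟨c, t, t', h1, fun u hu => h2 u (hT hu)⟩

/-- `bentFun` is affine on each of the closed half planes `0 ≤ y` and `y ≤ 0`, so its sign on the
points passes to the hull of each part separately. -/
theorem Cut.disjoint_doubleHull {x y : Plane →ᵃ[ℝ] ℝ} {S T : Finset Plane} (h : Cut x y S T) :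
    Disjoint (doubleHull y S) (doubleHull y T) := by
  obtain ⟨c, t, t', h1, h2⟩ := h
  have hS : ∀ z ∈ doubleHull y S, bentFun x y c t t' z < 0 := by
    rintro z (hz | hz)
    · have : z ∈ {w | 0 ≤ y w} ∩ {w | (x - t • y) w < c} := by
        refine convexHull_min ?_ ((convex_affine_ge y 0).inter (convex_affine_lt _ c)) hz
        rintro w ⟨hw, hyw⟩
        have := h1 w hw
        rw [bentFun_of_nonneg _ _ _ _ _ hyw] at this
        exact ⟨hyw, sub_neg.1 this⟩
      rw [bentFun_of_nonneg _ _ _ _ _ this.1]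
      exact sub_neg.2 this.2
    · have : z ∈ {w | y w ≤ 0} ∩ {w | (x - t' • y) w < c} := by
        refine convexHull_min ?_ ((convex_affine_le y 0).inter (convex_affine_lt _ c)) hz
        rintro w ⟨hw, hyw⟩
        have := h1 w hw
        rw [bentFun_of_nonpos _ _ _ _ _ hyw] at this
        exact ⟨hyw, sub_neg.1 this⟩
      rw [bentFun_of_nonpos _ _ _ _ _ this.1]
      exact sub_neg.2 this.2
  have hT : ∀ z ∈ doubleHull y T, 0 < bentFun x y c t t' z := by
    rintro z (hz | hz)
    · have : z ∈ {w | 0 ≤ y w} ∩ {w | c < (x - t • y) w} := by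
        refine convexHull_min ?_ ((convex_affine_ge y 0).inter (convex_affine_gt _ c)) hz
        rintro w ⟨hw, hyw⟩
        have := h2 w hw
        rw [bentFun_of_nonneg _ _ _ _ _ hyw] at this
        exact ⟨hyw, sub_pos.1 this⟩
      rw [bentFun_of_nonneg _ _ _ _ _ this.1]
      exact sub_pos.2 this.2
    · have : z ∈ {w | y w ≤ 0} ∩ {w | c < (x - t' • y) w} := by
        refine convexHull_min ?_ ((convex_affine_le y 0).inter (convex_affine_gt _ c)) hz
        rintro w ⟨hw, hyw⟩
        have := h2 w hw
        rw [bentFun_of_nonpos _ _ _ _ _ hyw] at this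
        exact ⟨hyw, sub_pos.1 this⟩
      rw [bentFun_of_nonpos _ _ _ _ _ this.1]
      exact sub_pos.2 this.2
  rw [Set.disjoint_left]
  intro z hz hz'
  linarith [hS z hz, hT z hz']

/-- One can cut off prescribed numbers of points on, above and below a line. -/
theorem exists_cut (x y : Plane →ᵃ[ℝ] ℝ) (hxy : ∀ u v, x u = x v → y u = y v → u = v)
    (P : Finset Plane) {j a b : ℕ} (hj : j ≤ (P.filter (y · = 0)).card)
    (ha : a ≤ (P.filter (0 < y ·)).card) (hb : b ≤ (P.filter (y · < 0)).card) :
    ∃ T ⊆ P, (T.filter (y · = 0)).card = j ∧ (T.filter (0 < y ·)).card = a ∧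
      (T.filter (y · < 0)).card = b ∧ Cut x y T (P \ T) := by
  classical
  obtain ⟨TJ, hTJ, rfl, t₀, hJ1, hJ2⟩ := exists_threshold (P.filter (y · = 0)) x (by
    intro u hu v hv h
    simp only [Finset.coe_filter, Set.mem_ofPred_eq] at hu hv
    exact hxy u v h (hu.2.trans hv.2.symm)) hj
  have hc1 : ∀ᶠ c in 𝓝[>] t₀, ∀ u ∈ P.filter (y · = 0), u ∉ TJ → c < x u := by
    refine (eventually_all_finset _).2 fun u hu => ?_
    by_cases h : u ∈ TJ
    · simp [h]
    · filter_upwards [Ioo_mem_nhdsGT (hJ2 u hu h)] with c hc _ using hc.2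
  -- For generic `c`, no line through `(c, 0)` other than `y = 0` contains two points of `P`, so the
  -- directions above and below can be ordered strictly.
  have hc2 : ∀ᶠ c in 𝓝[>] t₀, ∀ u ∈ P, ∀ v ∈ P, y u ≠ 0 → u ≠ v →
      (x u - c) * y v ≠ (x v - c) * y u := by
    refine (eventually_all_finset _).2 fun u hu => (eventually_all_finset _).2 fun v hv => ?_
    by_cases h : y u = y v
    · refine Eventually.of_forall fun c hyu huv h' => huv (hxy u v ?_ h)
      rw [h] at hyu h'
      linarith [mul_right_cancel₀ hyu h']
    · filter_upwards [eventually_mul_ne (sub_ne_zero.2 h) (x v * y u - x u * y v) t₀]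
        with c hc _ _ h'
      exact hc (by linarith)
  obtain ⟨c, ⟨hc1, hc2⟩, hc0⟩ := ((hc1.and hc2).and self_mem_nhdsWithin).exists
  have hc0 : t₀ < c := hc0
  have hinj : ∀ u ∈ P, ∀ v ∈ P, y u ≠ 0 → y v ≠ 0 → (x u - c) / y u = (x v - c) / y v → u = v := by
    intro u hu v hv hyu hyv h
    by_contra huv
    exact hc2 u hu v hv hyu huv ((div_eq_div_iff hyu hyv).1 h)
  obtain ⟨TA, hTA, rfl, t, hA1, hA2⟩ := exists_threshold (P.filter (0 < y ·))
    (fun w => (x w - c) / y w) (by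
      intro u hu v hv h
      simp only [Finset.coe_filter, Set.mem_ofPred_eq] at hu hv
      exact hinj u hu.1 v hv.1 hu.2.ne' hv.2.ne' h) ha
  -- Dividing by `y < 0` reverses left and right. The sign makes the leftmost directions the
  -- smallest ones, and accounts for the slope parameter `-t'` below.
  obtain ⟨TB, hTB, rfl, t', hB1, hB2⟩ := exists_threshold (P.filter (y · < 0))
    (fun w => -((x w - c) / y w)) (by
      intro u hu v hv h
      simp only [Finset.coe_filter, Set.mem_ofPred_eq] at hu hv
      exact hinj u hu.1 v hv.1 hu.2.ne hv.2.ne (neg_injective h)) hb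
  have hJm : ∀ u ∈ TJ, u ∈ P ∧ y u = 0 := fun u hu => Finset.mem_filter.1 (hTJ hu)
  have hAm : ∀ u ∈ TA, u ∈ P ∧ 0 < y u := fun u hu => Finset.mem_filter.1 (hTA hu)
  have hBm : ∀ u ∈ TB, u ∈ P ∧ y u < 0 := fun u hu => Finset.mem_filter.1 (hTB hu)
  refine ⟨TJ ∪ TA ∪ TB, ?_, ?_, ?_, ?_, c, t, -t', ?_, ?_⟩
  · refine Finset.union_subset (Finset.union_subset ?_ ?_) ?_
    exacts [fun u hu => (hJm u hu).1, fun u hu => (hAm u hu).1, fun u hu => (hBm u hu).1]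
  · congr 1
    ext u
    simp only [Finset.mem_filter, Finset.mem_union]
    constructor
    · rintro ⟨(h | h) | h, h0⟩
      · exact h
      · linarith [(hAm u h).2]
      · linarith [(hBm u h).2]
    · exact fun h => ⟨Or.inl (Or.inl h), (hJm u h).2⟩
  · congr 1
    ext u
    simp only [Finset.mem_filter, Finset.mem_union]
    constructor
    · rintro ⟨(h | h) | h, h0⟩
      · linarith [(hJm u h).2]
      · exact h
      · linarith [(hBm u h).2]
    · exact fun h => ⟨Or.inl (Or.inr h), (hAm u h).2⟩
  · congr 1
    ext u
    simp only [Finset.mem_filter, Finset.mem_union]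
    constructor
    · rintro ⟨(h | h) | h, h0⟩
      · linarith [(hJm u h).2]
      · linarith [(hAm u h).2]
      · exact h
    · exact fun h => ⟨Or.inr h, (hBm u h).2⟩
  · intro u hu
    rcases Finset.mem_union.1 hu with hu | hu
    rcases Finset.mem_union.1 hu with hu | hu
    · have h1 := (hJm u hu).2
      have h2 := hJ1 u hu
      rw [bentFun_of_nonneg _ _ _ _ _ h1.ge]
      simp [h1]
      linarith
    · have h1 := (hAm u hu).2
      have h2 := hA1 u hu
      rw [div_lt_iff₀ h1] at h2
      rw [bentFun_of_nonneg _ _ _ _ _ h1.le]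
      simp
      linarith
    · have h1 := (hBm u hu).2
      have h2 := hB1 u hu
      rw [neg_lt, lt_div_iff_of_neg h1] at h2
      rw [bentFun_of_nonpos _ _ _ _ _ h1.le]
      simp
      linarith
  · intro u hu
    simp only [Finset.mem_sdiff, Finset.mem_union, not_or] at hu
    obtain ⟨huP, ⟨huJ, huA⟩, huB⟩ := hu
    rcases lt_trichotomy (y u) 0 with h1 | h1 | h1
    · have h2 := hB2 u (Finset.mem_filter.2 ⟨huP, h1⟩) huB
      rw [lt_neg, div_lt_iff_of_neg h1] at h2
      rw [bentFun_of_nonpos _ _ _ _ _ h1.le]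
      simp
      linarith
    · have h2 := hc1 u (Finset.mem_filter.2 ⟨huP, h1⟩) huJ
      rw [bentFun_of_nonneg _ _ _ _ _ h1.ge]
      simp [h1]
      linarith
    · have h2 := hA2 u (Finset.mem_filter.2 ⟨huP, h1⟩) huA
      rw [lt_div_iff₀ h1] at h2
      rw [bentFun_of_nonneg _ _ _ _ _ h1.le]
      simp
      linarith

theorem card_filter_sdiff {α : Type*} [DecidableEq α] {T P : Finset α} (h : T ⊆ P) (p : α → Prop)
    [DecidablePred p] :
    ((P \ T).filter p).card + (T.filter p).card = (P.filter p).card := by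
  rw [← Finset.card_union_of_disjoint
    (Finset.disjoint_filter_filter Finset.sdiff_disjoint), ← Finset.filter_union,
    Finset.sdiff_union_of_subset h]

/-- A finite set can be divided into pieces that are separated by bent lines and have prescribed
numbers of points on, above and below a line. -/
theorem exists_cut_family {ι : Type*} (x y : Plane →ᵃ[ℝ] ℝ)
    (hxy : ∀ u v, x u = x v → y u = y v → u = v) (j a b : ι → ℕ) (I : Finset ι) :
    ∀ P : Finset Plane, ∑ i ∈ I, j i = (P.filter (y · = 0)).card →
    ∑ i ∈ I, a i = (P.filter (0 < y ·)).card → ∑ i ∈ I, b i = (P.filter (y · < 0)).card →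
    ∃ S : ι → Finset Plane, (∀ w, w ∈ P ↔ ∃ i ∈ I, w ∈ S i) ∧
      (∀ i ∈ I, ((S i).filter (y · = 0)).card = j i ∧ ((S i).filter (0 < y ·)).card = a i ∧
        ((S i).filter (y · < 0)).card = b i) ∧
      ∀ i ∈ I, ∀ k ∈ I, i ≠ k → Cut x y (S i) (S k) ∨ Cut x y (S k) (S i) := by
  classical
  induction I using Finset.induction_on with
  | empty =>
    intro P h1 h2 h3
    refine ⟨fun _ => ∅, fun w => ?_, by simp, by simp⟩
    simp only [Finset.sum_empty] at h1 h2 h3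
    have hJ := Finset.card_eq_zero.1 h1.symm
    have hA := Finset.card_eq_zero.1 h2.symm
    have hB := Finset.card_eq_zero.1 h3.symm
    simp only [Finset.notMem_empty, false_and, exists_false, iff_false]
    intro hw
    rcases lt_trichotomy (y w) 0 with h | h | h
    · exact Finset.notMem_empty w (hB ▸ Finset.mem_filter.2 ⟨hw, h⟩)
    · exact Finset.notMem_empty w (hJ ▸ Finset.mem_filter.2 ⟨hw, h⟩)
    · exact Finset.notMem_empty w (hA ▸ Finset.mem_filter.2 ⟨hw, h⟩)
  | insert i I hi ih =>
    intro P h1 h2 h3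
    rw [Finset.sum_insert hi] at h1 h2 h3
    obtain ⟨T, hTP, hTj, hTa, hTb, hcut⟩ := exists_cut x y hxy P (j := j i) (a := a i) (b := b i)
      (by omega) (by omega) (by omega)
    have c1 := card_filter_sdiff hTP (y · = 0)
    have c2 := card_filter_sdiff hTP (0 < y ·)
    have c3 := card_filter_sdiff hTP (y · < 0)
    obtain ⟨S, hS, hcard, hcuts⟩ := ih (P \ T) (by omega) (by omega) (by omega)
    have hSi : ∀ k ∈ I, Function.update S i T k = S k := fun k hk =>
      Function.update_of_ne (ne_of_mem_of_not_mem hk hi) _ _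
    have hsub : ∀ k ∈ I, S k ⊆ P \ T := fun k hk w hw => (hS w).2 ⟨k, hk, hw⟩
    refine ⟨Function.update S i T, fun w => ?_, fun k hk => ?_, fun k hk k' hk' hne => ?_⟩
    · rw [Finset.exists_mem_insert, Function.update_self]
      have h4 := hS w
      rw [Finset.mem_sdiff] at h4
      have h5 : (∃ k ∈ I, w ∈ Function.update S i T k) ↔ ∃ k ∈ I, w ∈ S k := by
        refine exists_congr fun k => and_congr_right fun hk => ?_
        rw [hSi k hk]
      rw [h5, ← h4]
      constructor
      · exact fun h => (em (w ∈ T)).imp_right fun h' => ⟨h, h'⟩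
      · rintro (h | h)
        exacts [hTP h, h.1]
    · rcases Finset.mem_insert.1 hk with rfl | hk
      · rw [Function.update_self]; exact ⟨hTj, hTa, hTb⟩
      · rw [hSi k hk]; exact hcard k hk
    · rcases Finset.mem_insert.1 hk with h4 | h4 <;> rcases Finset.mem_insert.1 hk' with h5 | h5
      · exact absurd (h4.trans h5.symm) hne
      · rw [h4, Function.update_self, hSi k' h5]
        exact Or.inl (hcut.mono (hsub k' h5))
      · rw [h5, Function.update_self, hSi k h4]
        exact Or.inr (hcut.mono (hsub k h4))
      · rw [hSi k h4, hSi k' h5]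
        exact hcuts k h4 k' h5 hne

/-! ### Distributing the points when one line carries many of them. -/

theorem exists_le_sum_eq {ι : Type*} (I : Finset ι) (f : ι → ℕ) :
    ∀ m ≤ ∑ i ∈ I, f i, ∃ g : ι → ℕ, (∀ i ∈ I, g i ≤ f i) ∧ ∑ i ∈ I, g i = m := by
  classical
  induction I using Finset.induction_on with
  | empty =>
    intro m hm
    exact ⟨fun _ => 0, by simp, by simpa [eq_comm] using hm⟩
  | insert i I hi ih =>
    intro m hm
    rw [Finset.sum_insert hi] at hm
    obtain ⟨g, hg, hsum⟩ := ih (m - min m (f i)) (by omega)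
    have hgi : ∀ k ∈ I, Function.update g i (min m (f i)) k = g k := fun k hk =>
      Function.update_of_ne (ne_of_mem_of_not_mem hk hi) _ _
    refine ⟨Function.update g i (min m (f i)), fun k hk => ?_, ?_⟩
    · rcases Finset.mem_insert.1 hk with rfl | hk
      · rw [Function.update_self]; exact min_le_right _ _
      · rw [hgi k hk]; exact hg k hk
    · rw [Finset.sum_insert hi, Function.update_self, Finset.sum_congr rfl hgi, hsum]
      omega

/-- `P` can be divided into vertex sets of `L i` points, for `i ∈ I`, of simple polygons whose
closed regions are contained in pairwise disjoint subsets of the convex hull of `P`. -/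
def HasPartition {ι : Type*} (I : Finset ι) (L : ι → ℕ) (P : Finset Plane) : Prop :=
  ∃ (S : ι → Finset Plane) (R : ι → Set Plane), (∀ w, w ∈ P ↔ ∃ i ∈ I, w ∈ S i) ∧
    (∀ i ∈ I, (S i).card = L i ∧ Polygonal (S i) (R i) ∧ R i ⊆ convexHull ℝ (P : Set Plane)) ∧
    ∀ i ∈ I, ∀ k ∈ I, i ≠ k → Disjoint (R i) (R k)

theorem card_filter_trichotomy (y : Plane → ℝ) (S : Finset Plane) :
    S.card = (S.filter (y · = 0)).card + (S.filter (0 < y ·)).card + (S.filter (y · < 0)).card := by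
  classical
  rw [← Finset.card_union_of_disjoint, ← Finset.card_union_of_disjoint]
  · congr 1
    ext w
    have := lt_trichotomy (y w) 0
    simp only [Finset.mem_union, Finset.mem_filter]
    tauto
  · rw [Finset.disjoint_left]
    intro w hw hw'
    have h1 := (Finset.mem_filter.1 hw').2
    rcases Finset.mem_union.1 hw with h | h <;> have h2 := (Finset.mem_filter.1 h).2 <;> linarith
  · rw [Finset.disjoint_left]
    intro w hw hw'
    have h1 := (Finset.mem_filter.1 hw').2
    have h2 := (Finset.mem_filter.1 hw).2
    linarith

theorem hasPartition_of_line {ι : Type*} (x y : Plane →ᵃ[ℝ] ℝ)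
    (hxy : ∀ u v, x u = x v → y u = y v → u = v) (I : Finset ι) (L : ι → ℕ)
    (hL : ∀ i ∈ I, 3 ≤ L i) (P : Finset Plane) (hP : P.card = ∑ i ∈ I, L i)
    (h2 : 2 * I.card ≤ (P.filter (y · = 0)).card)
    (h1 : (P.filter (y · = 0)).card + I.card ≤ P.card) : HasPartition I L P := by
  have htri := card_filter_trichotomy y P
  have hsum3 : ∑ i ∈ I, (L i - 3) + 3 * I.card = ∑ i ∈ I, L i := by
    rw [mul_comm, ← smul_eq_mul, ← Finset.sum_const, ← Finset.sum_add_distrib]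
    exact Finset.sum_congr rfl fun i hi => Nat.sub_add_cancel (hL i hi)
  -- Polygon `i` gets `g i + 2` points on the line; the bound `g i ≤ L i - 3` leaves it at least one
  -- point off the line.
  obtain ⟨g, hg, hgs⟩ := exists_le_sum_eq I (fun i => L i - 3)
    ((P.filter (y · = 0)).card - 2 * I.card) (by omega)
  have hj : ∑ i ∈ I, (g i + 2) = (P.filter (y · = 0)).card := by
    rw [Finset.sum_add_distrib, hgs, Finset.sum_const, smul_eq_mul]
    omega
  have ho : ∑ i ∈ I, (L i - 2 - g i) + ∑ i ∈ I, (g i + 2) = ∑ i ∈ I, L i := by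
    rw [← Finset.sum_add_distrib]
    refine Finset.sum_congr rfl fun i hi => ?_
    have := hL i hi
    have := hg i hi
    omega
  obtain ⟨a, ha, has⟩ := exists_le_sum_eq I (fun i => L i - 2 - g i) (P.filter (0 < y ·)).card
    (by omega)
  have hb : ∑ i ∈ I, (L i - 2 - g i - a i) = (P.filter (y · < 0)).card := by
    have : ∑ i ∈ I, (L i - 2 - g i - a i) + ∑ i ∈ I, a i = ∑ i ∈ I, (L i - 2 - g i) := by
      rw [← Finset.sum_add_distrib]
      exact Finset.sum_congr rfl fun i hi => Nat.sub_add_cancel (ha i hi)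
    omega
  obtain ⟨S, hS, hcard, hcut⟩ := exists_cut_family x y hxy _ _ _ I P hj has hb
  refine ⟨S, fun i => doubleHull y (S i), hS, fun i hi => ?_, fun i hi k hk hne => ?_⟩
  · obtain ⟨c1, c2, c3⟩ := hcard i hi
    have htri' := card_filter_trichotomy y (S i)
    have h3 := hL i hi
    have h4 := hg i hi
    have h5 : a i ≤ L i - 2 - g i := ha i hi
    refine ⟨by omega, polygonal_doubleHull x y hxy _ (by omega) ?_, ?_⟩
    · rcases Nat.eq_zero_or_pos (a i) with h | h
      · obtain ⟨w, hw⟩ := Finset.card_pos.1 (show 0 < ((S i).filter (y · < 0)).card by omega)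
        exact ⟨w, (Finset.mem_filter.1 hw).1, (Finset.mem_filter.1 hw).2.ne⟩
      · obtain ⟨w, hw⟩ := Finset.card_pos.1 (show 0 < ((S i).filter (0 < y ·)).card by omega)
        exact ⟨w, (Finset.mem_filter.1 hw).1, (Finset.mem_filter.1 hw).2.ne'⟩
    · exact (doubleHull_subset y (S i)).trans
        (convexHull_mono fun w hw => Finset.mem_coe.2 ((hS w).2 ⟨i, hi, hw⟩))
  · rcases hcut i hi k hk hne with h | h
    · exact h.disjoint_doubleHull
    · exact h.disjoint_doubleHull.symm

/-! ### Affine coordinates and supporting lines. -/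

/-- The coordinate functions of the plane, as affine maps. -/
noncomputable def coord (i : Fin 2) : Plane →ᵃ[ℝ] ℝ :=
  (EuclideanSpace.proj i : Plane →L[ℝ] ℝ).toLinearMap.toAffineMap

theorem coord_apply (i : Fin 2) (w : Plane) : coord i w = w i := rfl

theorem ext_coord {u v : Plane} (h0 : u 0 = v 0) (h1 : u 1 = v 1) : u = v := by
  ext i
  fin_cases i
  exacts [h0, h1]

/-- The line through two points is the zero set of one of a pair of affine coordinates. -/
theorem exists_coords {u v : Plane} (huv : u ≠ v) : ∃ x y : Plane →ᵃ[ℝ] ℝ,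
    (∀ w w', x w = x w' → y w = y w' → w = w') ∧ y u = 0 ∧ y v = 0 := by
  set d0 := v 0 - u 0 with hd0
  set d1 := v 1 - u 1 with hd1
  have hd : 0 < d0 ^ 2 + d1 ^ 2 := by
    by_contra! h
    have h0 : d0 = 0 := by nlinarith [sq_nonneg d0, sq_nonneg d1]
    have h1 : d1 = 0 := by nlinarith [sq_nonneg d0, sq_nonneg d1]
    exact huv (ext_coord (by linarith) (by linarith))
  refine ⟨d0 • coord 0 + d1 • coord 1,
    d0 • coord 1 - d1 • coord 0 - AffineMap.const ℝ Plane (d0 * u 1 - d1 * u 0), ?_, ?_, ?_⟩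
  · intro w w' h h'
    simp [coord_apply] at h h'
    have h0 : (d0 ^ 2 + d1 ^ 2) * (w 0 - w' 0) = 0 := by linear_combination d0 * h - d1 * h'
    have h1 : (d0 ^ 2 + d1 ^ 2) * (w 1 - w' 1) = 0 := by linear_combination d1 * h + d0 * h'
    exact ext_coord (sub_eq_zero.1 ((mul_eq_zero.1 h0).resolve_left hd.ne'))
      (sub_eq_zero.1 ((mul_eq_zero.1 h1).resolve_left hd.ne'))
  · simp [coord_apply]
  · simp [coord_apply, hd0, hd1]
    ring

theorem collinear_zero {x y : Plane →ᵃ[ℝ] ℝ} (hxy : ∀ u v, x u = x v → y u = y v → u = v) :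
    Collinear ℝ {w | y w = 0} := by
  by_cases h : ∃ u v, y u = 0 ∧ y v = 0 ∧ u ≠ v
  · obtain ⟨u, v, hu, hv, huv⟩ := h
    have hx : x v - x u ≠ 0 := fun h => huv (hxy u v (by linarith) (hu.trans hv.symm))
    refine (collinear_iff_of_mem (p₀ := u) hu).2 ⟨v - u, fun w hw => ⟨(x w - x u) / (x v - x u), ?_⟩⟩
    have key : ∀ f : Plane →ᵃ[ℝ] ℝ, f (((x w - x u) / (x v - x u)) • (v - u) +ᵥ u)
        = (x w - x u) / (x v - x u) * (f v - f u) + f u := by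
      intro f
      rw [f.map_vadd, map_smul, ← vsub_eq_sub v u, f.linearMap_vsub]
      simp
    apply hxy
    · rw [key, div_mul_cancel₀ _ hx]; ring
    · rw [key, hu, hv]; simpa using hw
  · push Not at h
    rcases Set.Subsingleton.eq_empty_or_singleton (s := {w | y w = 0}) fun u hu v hv => h u v hu hv
      with h' | ⟨u, h'⟩ <;> rw [h']
    exacts [collinear_empty ℝ Plane, collinear_singleton ℝ u]

theorem eq_zero_of_collinear {y : Plane →ᵃ[ℝ] ℝ} {S : Set Plane} (hS : Collinear ℝ S) {u v w : Plane}
    (hu : u ∈ S) (hv : v ∈ S) (hw : w ∈ S) (huv : u ≠ v) (hyu : y u = 0) (hyv : y v = 0) :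
    y w = 0 := by
  obtain ⟨r, rfl⟩ := mem_affineSpan_pair_iff_exists_lineMap_eq.1
    (hS.mem_affineSpan_of_mem_of_ne hu hv hw huv)
  rw [AffineMap.apply_lineMap, hyu, hyv, AffineMap.lineMap_same, AffineMap.const_apply]

/-- A finite set of at least two points has a supporting line containing two of them. -/
theorem exists_supporting_line (P : Finset Plane) (hP : 2 ≤ P.card) : ∃ x y : Plane →ᵃ[ℝ] ℝ,
    (∀ w w', x w = x w' → y w = y w' → w = w') ∧ (∀ w ∈ P, 0 ≤ y w) ∧
      2 ≤ (P.filter (y · = 0)).card := by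
  classical
  obtain ⟨p, hp, hmin⟩ := P.exists_min_image (fun w => w 1) (Finset.card_pos.1 (by omega))
  have two : ∀ (y : Plane →ᵃ[ℝ] ℝ) (q : Plane), q ∈ P → q ≠ p → y p = 0 → y q = 0 →
      2 ≤ (P.filter (y · = 0)).card := by
    intro y q hq hqp h0 h1
    exact Finset.one_lt_card.2 ⟨q, Finset.mem_filter.2 ⟨hq, h1⟩, p, Finset.mem_filter.2 ⟨hp, h0⟩,
      hqp⟩
  by_cases h : ∃ q ∈ P, q ≠ p ∧ q 1 = p 1
  · obtain ⟨q, hq, hqp, h1⟩ := h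
    refine ⟨coord 0, coord 1 - AffineMap.const ℝ Plane (p 1), fun w w' h h' => ?_, fun w hw => ?_,
      two _ q hq hqp ?_ ?_⟩
    · exact ext_coord h (by simpa [coord_apply] using h')
    · simpa [coord_apply] using hmin w hw
    · simp [coord_apply]
    · simp [coord_apply, h1]
  · push Not at h
    have hpos : ∀ w ∈ P, w ≠ p → 0 < w 1 - p 1 := fun w hw hwp =>
      sub_pos.2 (lt_of_le_of_ne (hmin w hw) (h w hw hwp).symm)
    -- With `p` the unique lowest point, the line to the point of least inverse slope seen from `p`
    -- has all points on one side.
    obtain ⟨q, hq, hqmin⟩ := (P.erase p).exists_min_image (fun w => (w 0 - p 0) / (w 1 - p 1))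
      (Finset.card_pos.1 (by rw [Finset.card_erase_of_mem hp]; omega))
    obtain ⟨hqp, hqP⟩ := Finset.mem_erase.1 hq
    set m := (q 0 - p 0) / (q 1 - p 1) with hm
    refine ⟨coord 1, coord 0 - m • coord 1 - AffineMap.const ℝ Plane (p 0 - m * p 1),
      fun w w' h h' => ?_, fun w hw => ?_, two _ q hqP hqp ?_ ?_⟩
    · simp [coord_apply] at h h'
      rw [h] at h'
      exact ext_coord (by linarith) h
    · by_cases hwp : w = p
      · simp [coord_apply, hwp]
      · have h1 := hqmin w (Finset.mem_erase.2 ⟨hwp, hw⟩)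
        rw [le_div_iff₀ (hpos w hw hwp)] at h1
        simp [coord_apply]
        linarith
    · simp [coord_apply]
    · have h1 : m * (q 1 - p 1) = q 0 - p 0 := div_mul_cancel₀ _ (hpos q hqP hqp).ne'
      simp [coord_apply]
      linarith

/-- A finite set of points on one side of a line can be separated from a subset that has prescribed
numbers of points on and off the line. -/
theorem exists_cut_convexHull (x y : Plane →ᵃ[ℝ] ℝ) (hxy : ∀ u v, x u = x v → y u = y v → u = v)
    (P : Finset Plane) (hP : ∀ w ∈ P, 0 ≤ y w) {j a : ℕ} (hj : j ≤ (P.filter (y · = 0)).card)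
    (ha : a ≤ (P.filter (0 < y ·)).card) :
    ∃ T ⊆ P, (T.filter (y · = 0)).card = j ∧ (T.filter (0 < y ·)).card = a ∧
      T.card = j + a ∧
      Disjoint (convexHull ℝ (T : Set Plane)) (convexHull ℝ ((P \ T : Finset Plane) : Set Plane)) := by
  obtain ⟨T, hT, h1, h2, h3, hcut⟩ := exists_cut x y hxy P hj ha (Nat.zero_le _)
  refine ⟨T, hT, h1, h2, by rw [card_filter_trichotomy y T, h1, h2, h3, add_zero], ?_⟩
  -- With no points below the line, the upper hull is the whole convex hull.
  have key : ∀ S ⊆ P, convexHull ℝ (S : Set Plane) ⊆ doubleHull y S := fun S hS =>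
    (convexHull_mono (t := {w | w ∈ S ∧ 0 ≤ y w}) fun _ hw => ⟨hw, hP _ (hS hw)⟩).trans
      Set.subset_union_left
  exact hcut.disjoint_doubleHull.mono (key T hT) (key _ Finset.sdiff_subset)

/-! ### Induction on the number of polygons. -/

theorem hasPartition_of_collinear_card_le {ι : Type*} (L : ι → ℕ) (n : ℕ) :
    ∀ (I : Finset ι) (P : Finset Plane), I.card = n → (∀ i ∈ I, 3 ≤ L i) → (∃ j ∈ I, 4 ≤ L j) →
      P.card = ∑ i ∈ I, L i →
      (∀ S ⊆ P, Collinear ℝ (S : Set Plane) → S.card + I.card ≤ P.card) → HasPartition I L P := by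
  classical
  induction n with
  | zero =>
    rintro I P hI - ⟨j, hj, -⟩
    rw [Finset.card_eq_zero.1 hI] at hj
    exact absurd hj (Finset.notMem_empty j)
  | succ n ih =>
    rintro I P hI hL ⟨j, hj, hLj⟩ hP hcol
    have hsum : ∀ I' ⊆ I, j ∈ I' → 3 * I'.card + 1 ≤ ∑ i ∈ I', L i := by
      intro I' hI' hj'
      rw [← Finset.add_sum_erase I' L hj']
      have : (I'.erase j).card • 3 ≤ ∑ i ∈ I'.erase j, L i :=
        Finset.card_nsmul_le_sum _ _ _ fun i hi => hL i (hI' (Finset.mem_of_mem_erase hi))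
      rw [Finset.card_erase_of_mem hj', smul_eq_mul] at this
      have : 0 < I'.card := Finset.card_pos.2 ⟨j, hj'⟩
      omega
    have hsumI := hsum I subset_rfl hj
    by_cases hrich : ∃ S ⊆ P, Collinear ℝ (S : Set Plane) ∧ 2 * I.card ≤ S.card
    · obtain ⟨S, hSP, hS, hScard⟩ := hrich
      obtain ⟨u, hu, v, hv, huv⟩ := Finset.one_lt_card.1 (show 1 < S.card by omega)
      obtain ⟨x, y, hxy, hyu, hyv⟩ := exists_coords huv
      refine hasPartition_of_line x y hxy I L hL P hP ?_ ?_
      · refine hScard.trans (Finset.card_le_card fun w hw => Finset.mem_filter.2 ⟨hSP hw, ?_⟩)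
        exact eq_zero_of_collinear hS hu hv hw huv hyu hyv
      · refine hcol _ (Finset.filter_subset _ _) ((collinear_zero hxy).subset fun w hw => ?_)
        exact (Finset.mem_filter.1 hw).2
    push Not at hrich
    obtain ⟨x, y, hxy, hnonneg, hline⟩ := exists_supporting_line P (by omega)
    have hJ := hrich (P.filter (y · = 0)) (Finset.filter_subset _ _)
      ((collinear_zero hxy).subset fun w hw => (Finset.mem_filter.1 hw).2)
    have htri := card_filter_trichotomy y P
    have hneg : (P.filter (y · < 0)).card = 0 :=
      Finset.card_eq_zero.2 (Finset.filter_eq_empty_iff.2 fun w hw => (hnonneg w hw).not_gt)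
    -- The supporting line has at least `2` but fewer than `2 * I.card` points, so `I` has a second
    -- index. Removing `i ≠ j` preserves the polygon with at least four vertices.
    obtain ⟨i, hi, hij⟩ : ∃ i ∈ I, i ≠ j := Finset.exists_mem_ne (by omega) j
    have hLi := hL i hi
    have herase := Finset.add_sum_erase I L hi
    have hsumE := hsum (I.erase i) (Finset.erase_subset _ _) (Finset.mem_erase.2 ⟨hij.symm, hj⟩)
    have hcardE := Finset.card_erase_of_mem hi
    -- As many points of the line as possible are removed, but one of the `L i` points is kept off
    -- it to avoid a collinear piece.
    obtain ⟨T, hTP, hT0, hT1, hTc, hdisj⟩ := exists_cut_convexHull x y hxy P hnonneg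
      (j := min (P.filter (y · = 0)).card (L i - 1))
      (a := L i - min (P.filter (y · = 0)).card (L i - 1)) (min_le_left _ _) (by omega)
    have hPT : (P \ T).card = P.card - T.card := Finset.card_sdiff_of_subset hTP
    obtain ⟨S, R, hS, hSR, hdisjR⟩ := ih (I.erase i) (P \ T) (by omega)
      (fun k hk => hL k (Finset.mem_of_mem_erase hk)) ⟨j, Finset.mem_erase.2 ⟨hij.symm, hj⟩, hLj⟩
      (by omega) (fun S' hS' hcol' => by
        have := hrich S' (hS'.trans Finset.sdiff_subset) hcol'
        omega)
    have hTpoly : Polygonal T (convexHull ℝ (T : Set Plane)) := by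
      obtain ⟨w, hw⟩ := Finset.card_pos.1 (show 0 < (T.filter (0 < y ·)).card by omega)
      obtain ⟨C, hC, hCr, hCR⟩ := polygonal_doubleHull x y hxy T (by omega)
        ⟨w, (Finset.mem_filter.1 hw).1, (Finset.mem_filter.1 hw).2.ne'⟩
      exact ⟨C, hC, hCr, hCR.trans (doubleHull_subset y T)⟩
    refine ⟨Function.update S i T, Function.update R i (convexHull ℝ (T : Set Plane)), fun w => ?_,
      fun k hk => ?_, fun k hk k' hk' hne => ?_⟩
    · have h4 := hS w
      rw [Finset.mem_sdiff] at h4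
      constructor
      · intro hw
        by_cases hwT : w ∈ T
        · exact ⟨i, hi, by rwa [Function.update_self]⟩
        · obtain ⟨k, hk, hwk⟩ := h4.1 ⟨hw, hwT⟩
          obtain ⟨hki, hkI⟩ := Finset.mem_erase.1 hk
          exact ⟨k, hkI, by rwa [Function.update_of_ne hki]⟩
      · rintro ⟨k, hk, hwk⟩
        by_cases hki : k = i
        · rw [hki, Function.update_self] at hwk
          exact hTP hwk
        · rw [Function.update_of_ne hki] at hwk
          exact (h4.2 ⟨k, Finset.mem_erase.2 ⟨hki, hk⟩, hwk⟩).1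
    · by_cases hki : k = i
      · rw [hki, Function.update_self, Function.update_self]
        exact ⟨by omega, hTpoly, convexHull_mono (Finset.coe_subset.2 hTP)⟩
      · rw [Function.update_of_ne hki, Function.update_of_ne hki]
        obtain ⟨h5, h6, h7⟩ := hSR k (Finset.mem_erase.2 ⟨hki, hk⟩)
        exact ⟨h5, h6, h7.trans (convexHull_mono (Finset.coe_subset.2 Finset.sdiff_subset))⟩
    · by_cases hki : k = i
      · have hki' : k' ≠ i := fun h => hne (hki.trans h.symm)
        rw [hki, Function.update_self, Function.update_of_ne hki']
        exact hdisj.mono_right (hSR k' (Finset.mem_erase.2 ⟨hki', hk'⟩)).2.2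
      · rw [Function.update_of_ne hki]
        by_cases hki' : k' = i
        · rw [hki', Function.update_self]
          exact (hdisj.mono_right (hSR k (Finset.mem_erase.2 ⟨hki, hk⟩)).2.2).symm
        · rw [Function.update_of_ne hki']
          exact hdisjR k (Finset.mem_erase.2 ⟨hki, hk⟩) k' (Finset.mem_erase.2 ⟨hki', hk'⟩) hne

/-! ### Necessity and the main theorem. -/

/-- The vertices of a simple polygon are not collinear. -/
theorem IsSimple.not_collinear {n : ℕ} {C : Polygon Plane n} (hC : IsSimple C) :
    ¬ Collinear ℝ (Set.range C.vertices) := by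
  intro hcol
  have h3 := hC.three_le
  obtain ⟨p, d, hd⟩ := (collinear_iff_exists_forall_eq_smul_vadd _).1 hcol
  have hd : ∀ i, ∃ r : ℝ, C.vertices i = r • d +ᵥ p := fun i => hd _ ⟨i, rfl⟩
  choose r hr using hd
  have hbtw : ∀ i j k, r i ≤ r j → r j ≤ r k →
      C.vertices j ∈ affineSegment ℝ (C.vertices i) (C.vertices k) := by
    intro i j k hij hjk
    have h : Wbtw ℝ (r i) (r j) (r k) := by
      rw [Wbtw, affineSegment_eq_segment, segment_eq_Icc (hij.trans hjk)]
      exact ⟨hij, hjk⟩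
    have h' := h.map (AffineMap.lineMap p (d +ᵥ p) : ℝ →ᵃ[ℝ] Plane)
    simp only [AffineMap.lineMap_apply, vadd_vsub] at h'
    rw [hr i, hr j, hr k]
    exact h'
  -- At a vertex farthest along the line, both edges leave in the same direction, so the nearer
  -- neighbour lies on both, although they may share only the vertex itself.
  obtain ⟨i, -, hi⟩ := Finset.univ.exists_max_image r ⟨(⟨0, by omega⟩ : Fin n), Finset.mem_univ _⟩
  have hrot : finRotate n i ≠ i := by
    rw [Ne, Fin.ext_iff, val_finRotate]
    split_ifs <;> omega
  obtain ⟨k, rfl⟩ := (finRotate n).surjective i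
  have hcons := hC.consecutive k
  set i := finRotate n k with hik
  rcases le_total (r k) (r (finRotate n i)) with h | h
  · have h1 : C.vertices (finRotate n i) ∈ C.edgeSet ℝ k ∩ C.edgeSet ℝ i :=
      ⟨hbtw k _ i h (hi _ (Finset.mem_univ _)), right_mem_affineSegment _ _ _⟩
    rw [hcons] at h1
    exact hrot (hC.injective h1)
  · have h1 : C.vertices k ∈ C.edgeSet ℝ k ∩ C.edgeSet ℝ i := by
      refine ⟨left_mem_affineSegment _ _ _, ?_⟩
      rw [Polygon.edgeSet, affineSegment_comm]
      exact hbtw _ k i h (hi _ (Finset.mem_univ _))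
    rw [hcons] at h1
    have h2 : k = i := hC.injective h1
    exact hrot (by rw [← h2, ← hik, ← h2])

end PolygonPartition

theorem mainTheorem2 (l : ℕ) (L : Fin l → ℕ) (hL : ∀ i, 3 ≤ L i) (hL4 : ∃ j, 4 ≤ L j)
    (P : Finset PolygonPartition.Plane) (hP : P.card = ∑ i, L i) :
    (∃ C : (i : Fin l) → Polygon PolygonPartition.Plane (L i),
      PolygonPartition.IsDisjointCyclePartition L P C) ↔
    ∀ S ⊆ P, Collinear ℝ (S : Set PolygonPartition.Plane) → S.card ≤ (∑ i, L i) - l := by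
  classical
  constructor
  · rintro ⟨C, hC⟩ S hS hcol
    have hout : ∀ i, ∃ w, w ∈ Set.range (C i).vertices ∧ w ∉ S := by
      intro i
      by_contra! h
      exact (hC.simple i).not_collinear (hcol.subset h)
    choose f hf hfS using hout
    have hfP : ∀ i, f i ∈ P := fun i =>
      Finset.mem_coe.1 (hC.vertices ▸ Set.mem_iUnion.2 ⟨i, hf i⟩)
    have hfreg : ∀ i, f i ∈ PolygonPartition.closedRegion (C i) := by
      intro i
      obtain ⟨k, hk⟩ := hf i
      refine Or.inl (Set.mem_iUnion.2 ⟨k, ?_⟩)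
      rw [← hk]
      exact left_mem_affineSegment _ _ _
    have hinj : Function.Injective f := by
      intro i k h
      by_contra hne
      exact Set.disjoint_left.1 (hC.disjoint i k hne) (hfreg i) (h ▸ hfreg k)
    have h1 : (Finset.univ.image f).card = l := by
      rw [Finset.card_image_of_injective _ hinj, Finset.card_fin]
    have h2 : S ∪ Finset.univ.image f ⊆ P := Finset.union_subset hS fun w hw => by
      obtain ⟨i, -, rfl⟩ := Finset.mem_image.1 hw
      exact hfP i
    have h3 : Disjoint S (Finset.univ.image f) := Finset.disjoint_left.2 fun w hw hw' => by
      obtain ⟨i, -, rfl⟩ := Finset.mem_image.1 hw'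
      exact hfS i hw
    have h4 := Finset.card_le_card h2
    rw [Finset.card_union_of_disjoint h3, h1, hP] at h4
    omega
  · intro h
    -- This makes the natural number subtraction in the bound exact.
    have hl : l ≤ ∑ i, L i := by
      calc l = ∑ i : Fin l, 1 := by simp
        _ ≤ ∑ i, L i := Finset.sum_le_sum fun i _ => by have := hL i; omega
    obtain ⟨j, hj⟩ := hL4
    obtain ⟨S, R, hS, hSR, hdisj⟩ := PolygonPartition.hasPartition_of_collinear_card_le L l
      Finset.univ P (Finset.card_fin l) (fun i _ => hL i) ⟨j, Finset.mem_univ j, hj⟩ hP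
      (fun S hS hcol => by
        have := h S hS hcol
        rw [Finset.card_fin]
        omega)
    have hpoly : ∀ i, ∃ C : Polygon PolygonPartition.Plane (L i),
        PolygonPartition.IsSimple C ∧ Set.range C.vertices = S i ∧
        PolygonPartition.closedRegion C ⊆ R i := by
      intro i
      obtain ⟨h1, h2, -⟩ := hSR i (Finset.mem_univ i)
      rw [← h1]
      exact h2
    choose C hC hCS hCR using hpoly
    refine ⟨C, hC, fun i k hne => ?_, ?_⟩
    · exact (hdisj i (Finset.mem_univ i) k (Finset.mem_univ k) hne).mono (hCR i) (hCR k)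
    · ext w
      simp [hCS, hS]
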